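/- Let $p=2$, let $\theta_1^0\in\mathbb R^2$ be a unit vector, $v>0$, and let $(r_n)$ be a positive real sequence with $\sqrt n\,r_n\to 0$. Let $(\mu_n)$ be any sequence in $\mathbb R^2$ and $(\sigma_n)$ any positive real sequence. For every $n$, let $X_{n1},\dots,X_{nn}$ be independent random vectors, each with the bivariate normal distribution with mean $\mu_n$ and covariance matrix $\sigma_n^2\,(I_2+r_n v\,\theta_1^0\theta_1^{0\prime})$, so that the null hypothesis $\mathcal H_0:\theta_1=\theta_1^0$ on the first eigenvector of the covariance matrix holds. Put $\bar X_n=\frac1n\sum_{i=1}^n X_{ni}$ and $S_n=\frac1n\sum_{i=1}^n (X_{ni}-\bar X_n)(X_{ni}-\bar X_n)'$, let $\hat\lambda_{n1}$ be the largest eigenvalue of $S_n$, and let $$Q_A^{(n)}=n\big(\hat\lambda_{n1}\,\theta_1^{0\prime}S_n^{-1}\theta_1^0+\hat\lambda_{n1}^{-1}\,\theta_1^{0\prime}S_n\theta_1^0-2\big)$$ be the Anderson test statistic. Then $$Q_A^{(n)}\xrightarrow{\mathcal D}4\chi^2_1 .$$ Consequently, for every $\alpha\in(0,1)$, the level-$\alpha$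 Anderson test, which rejects $\mathcal H_0$ when $Q_A^{(n)}>\chi^2_{1,1-\alpha}$ (the $\alpha$-upper quantile of the $\chi^2_1$ distribution), has an asymptotic size under the null hypothesis that is strictly larger than $\alpha$: $$\lim_{n\to\infty}\mathrm P\big[Q_A^{(n)}>\chi^2_{1,1-\alpha}\big]=\mathrm P\big[4Y>\chi^2_{1,1-\alpha}\big]>\alpha,\qquad Y\sim\chi^2_1 .$$ -/

import Mathlib

open MeasureTheory ProbabilityTheory Filter Topology Matrix

noncomputable section

/-- The single-spiked covariance matrix `σ² (I + r v θ θ')`. -/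
def spikedCov {p : ℕ} (σ r v : ℝ) (θ : EuclideanSpace ℝ (Fin p)) : Matrix (Fin p) (Fin p) ℝ :=
  σ ^ 2 • (1 + (r * v) • vecMulVec (fun i => θ i) (fun i => θ i))

/-- The sample average of `x₁, …, xₙ`. -/
def sampleMean {p n : ℕ} (x : Fin n → EuclideanSpace ℝ (Fin p)) : EuclideanSpace ℝ (Fin p) :=
  (n : ℝ)⁻¹ • ∑ i, x i

/-- The sample covariance matrix `S = n⁻¹ ∑ᵢ (xᵢ - x̄)(xᵢ - x̄)'`. -/
def sampleCov {p n : ℕ} (x : Fin n → EuclideanSpace ℝ (Fin p)) : Matrix (Fin p) (Fin p) ℝ :=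
  (n : ℝ)⁻¹ • ∑ i, vecMulVec (fun j => x i j - sampleMean x j) (fun j => x i j - sampleMean x j)

theorem sampleCov_isHermitian {p n : ℕ} (x : Fin n → EuclideanSpace ℝ (Fin p)) :
    (sampleCov x).IsHermitian := by
  ext j k
  simp [sampleCov, Matrix.sum_apply, vecMulVec_apply, mul_comm]

/-- The largest eigenvalue of the sample covariance matrix (Mathlib's `eigenvalues₀` lists the
eigenvalues, with multiplicity, in decreasing order). -/
def sampleTopEigenvalue {p n : ℕ} [NeZero p] (x : Fin n → EuclideanSpace ℝ (Fin p)) : ℝ :=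
  (sampleCov_isHermitian x).eigenvalues₀
    ⟨0, by rw [Fintype.card_fin]; exact Nat.pos_of_ne_zero (NeZero.ne p)⟩

/-- The Anderson statistic `n (λ̂₁ θ₀' S⁻¹ θ₀ + λ̂₁⁻¹ θ₀' S θ₀ - 2)`. -/
def andersonStat {p n : ℕ} [NeZero p] (θ₀ : EuclideanSpace ℝ (Fin p))
    (x : Fin n → EuclideanSpace ℝ (Fin p)) : ℝ :=
  (n : ℝ) * (sampleTopEigenvalue x * ((fun i => θ₀ i) ⬝ᵥ (sampleCov x)⁻¹ *ᵥ (fun i => θ₀ i))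
    + (sampleTopEigenvalue x)⁻¹ * ((fun i => θ₀ i) ⬝ᵥ sampleCov x *ᵥ (fun i => θ₀ i)) - 2)

/-- The chi-square distribution with `k` degrees of freedom: the law of the sum of the squares
of `k` independent standard normal random variables. -/
def chiSquare (k : ℕ) : Measure ℝ :=
  (Measure.pi (fun _ : Fin k => gaussianReal 0 1)).map (fun z => ∑ i, z i ^ 2)

instance chiSquare_isProbabilityMeasure (k : ℕ) : IsProbabilityMeasure (chiSquare k) :=
  Measure.isProbabilityMeasure_map (Measurable.aemeasurable (by fun_prop))

/-- The `α`-upper quantile (quantile of order `1 - α`) of a probability measure on `ℝ`. -/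
def upperQuantile (ν : Measure ℝ) (α : ℝ) : ℝ :=
  sInf {x : ℝ | 1 - α ≤ cdf ν x}

/-- The level-`α` Anderson test of `θ₁ = θ₀` rejects on the sample `x`. -/
def AndersonRejects {p n : ℕ} [NeZero p] (θ₀ : EuclideanSpace ℝ (Fin p)) (α : ℝ)
    (x : Fin n → EuclideanSpace ℝ (Fin p)) : Prop :=
  upperQuantile (chiSquare (p - 1)) α < andersonStat θ₀ x

end

/-! In the orthonormal basis formed by `θ` and its rotation by a right angle, let `S / σ²` have
diagonal entries `a`, `d` and off-diagonal entry `b`, and let `D = √((a - d)² + 4b²)` be its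
eigenvalue gap. The Anderson statistic is then exactly `n D (D - (a - d)) / (2 (ad - b²))`; neither
the mean nor the scale enters.

Since `√n r → 0`, the spike is too weak to separate the eigenvalues: `√n (a - d)` and `2 √n b`
converge jointly to `2z₁` and `2z₂`, with `z` standard normal in the plane, while the determinant
tends to 1. The limit is therefore `2‖z‖(‖z‖ - z₁)`. In polar coordinates this is `2R²(1 - cos φ) =
4R² sin²(φ/2)` with `φ` uniform and independent of `R`. As `sin²` has period `π`, replacing `φ/2` by
`φ` does not change the law, which is that of `4R² sin² φ = 4z₂²`, i.e. `4χ²₁`.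

The exact formula is `andersonStat_spikedMap`, the limit passage
`tendstoInDistribution_andersonStat_spikedMap`, and the limit law
`map_gaussian_prod_norm_mul_norm_sub`. The size exceeds `α` because the quantile `q` is positive, so
that `q/4 < q`. -/

/-! ### Closed form of the statistic for `2 × 2` matrices -/

/-- The largest eigenvalue of a symmetric `2 × 2` matrix in terms of its trace and determinant. -/
theorem Matrix.IsHermitian.eigenvalues₀_zero_fin_two {A : Matrix (Fin 2) (Fin 2) ℝ}
    (hA : A.IsHermitian) (h : 0 < Fintype.card (Fin 2)) :
    hA.eigenvalues₀ ⟨0, h⟩ = (A.trace + √(A.trace ^ 2 - 4 * A.det)) / 2 := by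
  have h1 : 1 < Fintype.card (Fin 2) := by simp
  have hroots := hA.roots_charpoly_eq_eigenvalues₀
  have htr : A.trace = hA.eigenvalues₀ ⟨0, h⟩ + hA.eigenvalues₀ ⟨1, h1⟩ := by
    rw [trace_eq_sum_roots_charpoly_of_splits hA.splits_charpoly, hroots]
    exact Fin.sum_univ_two _
  have hdet : A.det = hA.eigenvalues₀ ⟨0, h⟩ * hA.eigenvalues₀ ⟨1, h1⟩ := by
    rw [det_eq_prod_roots_charpoly_of_splits hA.splits_charpoly, hroots]
    exact Fin.prod_univ_two _
  have hle : hA.eigenvalues₀ ⟨1, h1⟩ ≤ hA.eigenvalues₀ ⟨0, h⟩ :=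
    hA.eigenvalues₀_antitone (by simp)
  rw [htr, hdet]
  set a := hA.eigenvalues₀ ⟨0, h⟩
  set b := hA.eigenvalues₀ ⟨1, h1⟩
  rw [show (a + b) ^ 2 - 4 * (a * b) = (a - b) ^ 2 by ring, Real.sqrt_sq (by linarith)]
  ring

/-- The Anderson statistic as an explicit function of the sample covariance matrix. -/
theorem andersonStat_eq {n : ℕ} (θ₀ : EuclideanSpace ℝ (Fin 2))
    (x : Fin n → EuclideanSpace ℝ (Fin 2)) :
    andersonStat θ₀ x = (n : ℝ) *
      ((((sampleCov x).trace + √((sampleCov x).trace ^ 2 - 4 * (sampleCov x).det)) / 2) *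
        ((sampleCov x).det⁻¹ * (sampleCov x 1 1 * θ₀ 0 ^ 2 -
          (sampleCov x 0 1 + sampleCov x 1 0) * (θ₀ 0 * θ₀ 1) + sampleCov x 0 0 * θ₀ 1 ^ 2)) +
      (((sampleCov x).trace + √((sampleCov x).trace ^ 2 - 4 * (sampleCov x).det)) / 2)⁻¹ *
        (sampleCov x 0 0 * θ₀ 0 ^ 2 + (sampleCov x 0 1 + sampleCov x 1 0) * (θ₀ 0 * θ₀ 1) +
          sampleCov x 1 1 * θ₀ 1 ^ 2) - 2) := by
  unfold andersonStat sampleTopEigenvalue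
  rw [Matrix.IsHermitian.eigenvalues₀_zero_fin_two, Matrix.inv_def, Ring.inverse_eq_inv',
    Matrix.adjugate_fin_two]
  simp only [mul_eq_mul_left_iff]
  left
  simp [Matrix.mulVec, dotProduct, Fin.sum_univ_two]
  ring

theorem sampleCov_apply {p n : ℕ} (x : Fin n → EuclideanSpace ℝ (Fin p)) (j k : Fin p) :
    sampleCov x j k =
      (n : ℝ)⁻¹ * ∑ i, (x i j - sampleMean x j) * (x i k - sampleMean x k) := by
  simp [sampleCov, Matrix.sum_apply, vecMulVec_apply]

theorem measurable_sampleCov_apply {p n : ℕ} (j k : Fin p) :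
    Measurable (fun x : Fin n → EuclideanSpace ℝ (Fin p) => sampleCov x j k) := by
  simp only [sampleCov_apply, sampleMean]
  fun_prop

theorem measurable_andersonStat {n : ℕ} (θ₀ : EuclideanSpace ℝ (Fin 2)) :
    Measurable (fun x : Fin n → EuclideanSpace ℝ (Fin 2) => andersonStat θ₀ x) := by
  have h := fun j k : Fin 2 => measurable_sampleCov_apply (n := n) j k
  simp only [andersonStat_eq, Matrix.trace_fin_two, Matrix.det_fin_two]
  have h00 := h 0 0
  have h01 := h 0 1
  have h10 := h 1 0
  have h11 := h 1 1
  fun_prop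

/-- The algebraic form of the Anderson statistic of a `2 × 2` covariance matrix with entries
`s₁₁, s₁₂, s₂₂` in the orthonormal basis whose first vector is the hypothesized one. -/
theorem anderson_algebra {a b d : ℝ} (hdet : 0 < a * d - b ^ 2) :
    ((a + d + √((a - d) ^ 2 + 4 * b ^ 2)) / 2) * ((a * d - b ^ 2)⁻¹ * d) +
      ((a + d + √((a - d) ^ 2 + 4 * b ^ 2)) / 2)⁻¹ * a - 2 =
    √((a - d) ^ 2 + 4 * b ^ 2) * (√((a - d) ^ 2 + 4 * b ^ 2) - (a - d)) /
      (2 * (a * d - b ^ 2)) := by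
  set D := √((a - d) ^ 2 + 4 * b ^ 2) with hD
  have hDsq : D ^ 2 = (a - d) ^ 2 + 4 * b ^ 2 := Real.sq_sqrt (by positivity)
  -- The two eigenvalues multiply to the determinant, so the inverse of the larger one is the
  -- smaller one over the determinant.
  have hprod : ((a + d + D) / 2) * ((a + d - D) / 2) = a * d - b ^ 2 := by
    linear_combination (-1 / 4) * hDsq
  have hne : (a + d + D) / 2 ≠ 0 := by
    intro h0
    rw [h0, zero_mul] at hprod
    exact hdet.ne hprod
  have hinv : ((a + d + D) / 2)⁻¹ = (a + d - D) / 2 * (a * d - b ^ 2)⁻¹ := by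
    rw [← hprod, _root_.mul_inv_rev]
    have h2 : (a + d - D) / 2 ≠ 0 := by
      intro h0
      rw [h0, mul_zero] at hprod
      exact hdet.ne hprod
    rw [← mul_assoc, mul_inv_cancel₀ h2, one_mul]
  rw [hinv]
  have h3 := hdet.ne'
  field_simp
  linear_combination -hDsq

/-! ### Removing mean, scale and rotation -/

noncomputable section

/-- The vector `θ` rotated by a right angle. -/
def rotateRight (θ : EuclideanSpace ℝ (Fin 2)) : EuclideanSpace ℝ (Fin 2) := !₂[-θ 1, θ 0]

/-- The affine map sending a standard normal pair to a normal vector with mean `m` and covariance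
`σ² (t θ θ' + θ^⊥ θ^⊥')`. -/
def spikedMap (m : EuclideanSpace ℝ (Fin 2)) (σ t : ℝ) (θ : EuclideanSpace ℝ (Fin 2))
    (y : ℝ × ℝ) : EuclideanSpace ℝ (Fin 2) :=
  m + σ • ((√t * y.1) • θ + y.2 • rotateRight θ)

/-- The empirical covariance of two real samples. -/
def empCov {n : ℕ} (a b : Fin n → ℝ) : ℝ :=
  (n : ℝ)⁻¹ * ∑ i, (a i - (n : ℝ)⁻¹ * ∑ l, a l) * (b i - (n : ℝ)⁻¹ * ∑ l, b l)

/-- Centring removes `m`, and the covariance is bilinear in the coordinates along `θ` and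
`rotateRight θ`. -/
theorem sampleCov_spikedMap {n : ℕ} (m : EuclideanSpace ℝ (Fin 2)) (σ : ℝ) {t : ℝ} (ht : 0 ≤ t)
    (θ : EuclideanSpace ℝ (Fin 2)) (y : Fin n → ℝ × ℝ) (j k : Fin 2) :
    sampleCov (fun i => spikedMap m σ t θ (y i)) j k =
      σ ^ 2 * (t * empCov (fun i => (y i).1) (fun i => (y i).1) * (θ j * θ k) +
        √t * empCov (fun i => (y i).1) (fun i => (y i).2) *
          (θ j * rotateRight θ k + rotateRight θ j * θ k) +
        empCov (fun i => (y i).2) (fun i => (y i).2) *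
          (rotateRight θ j * rotateRight θ k)) := by
  -- For the empty sample both sides vanish, since `(0 : ℝ)⁻¹ = 0`.
  rcases Nat.eq_zero_or_pos n with rfl | hn
  · simp [sampleCov_apply, empCov]
  have hn' : (n : ℝ) ≠ 0 := by positivity
  have hmean : ∀ j, sampleMean (fun i => spikedMap m σ t θ (y i)) j =
      m j + σ * (√t * ((n : ℝ)⁻¹ * ∑ l, (y l).1) * θ j +
        ((n : ℝ)⁻¹ * ∑ l, (y l).2) * rotateRight θ j) := by
    intro j
    simp only [sampleMean, spikedMap, PiLp.smul_apply, WithLp.ofLp_sum, Finset.sum_apply,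
      PiLp.add_apply, smul_eq_mul, Finset.sum_add_distrib, ← Finset.mul_sum, ← Finset.sum_mul]
    simp
    field_simp
  have hsq : √t ^ 2 = t := Real.sq_sqrt ht
  rw [sampleCov_apply]
  simp only [hmean, empCov]
  set p := (n : ℝ)⁻¹ * ∑ l, (y l).1
  set q := (n : ℝ)⁻¹ * ∑ l, (y l).2
  simp only [Finset.mul_sum, Finset.sum_mul, ← Finset.sum_add_distrib]
  refine Finset.sum_congr rfl fun i _ => ?_
  simp only [spikedMap, PiLp.add_apply, PiLp.smul_apply, smul_eq_mul]
  linear_combination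
    ((n : ℝ)⁻¹ * σ ^ 2 * ((y i).1 - p) ^ 2 * θ j * θ k) * hsq

theorem andersonStat_spikedMap {n : ℕ} (m : EuclideanSpace ℝ (Fin 2)) {σ t : ℝ} (hσ : 0 < σ)
    (ht : 0 ≤ t) {θ : EuclideanSpace ℝ (Fin 2)} (hθ : ‖θ‖ = 1) (y : Fin n → ℝ × ℝ)
    {a b d : ℝ} (ha : a = t * empCov (fun i => (y i).1) (fun i => (y i).1))
    (hb : b = √t * empCov (fun i => (y i).1) (fun i => (y i).2))
    (hd : d = empCov (fun i => (y i).2) (fun i => (y i).2))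
    (hdet : 0 < a * d - b ^ 2) :
    andersonStat θ (fun i => spikedMap m σ t θ (y i)) =
      n * (√((a - d) ^ 2 + 4 * b ^ 2) * (√((a - d) ^ 2 + 4 * b ^ 2) - (a - d)) /
        (2 * (a * d - b ^ 2))) := by
  have hθ2 : θ 0 ^ 2 + θ 1 ^ 2 = 1 := by
    have h := EuclideanSpace.real_norm_sq_eq θ
    rw [hθ, Fin.sum_univ_two] at h
    linarith
  have hS := sampleCov_spikedMap m σ ht θ y
  rw [← ha, ← hb, ← hd] at hS
  have hr0 : rotateRight θ 0 = -θ 1 := rfl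
  have hr1 : rotateRight θ 1 = θ 0 := rfl
  rw [andersonStat_eq, ← anderson_algebra hdet, Matrix.trace_fin_two, Matrix.det_fin_two]
  simp only [hS, hr0, hr1]
  set c := θ 0
  set s := θ 1
  -- `e1` to `e4` are the trace, the determinant, the determinant times `θ' S⁻¹ θ`, and `θ' S θ`,
  -- all evaluated in the rotated basis.
  have e1 : σ ^ 2 * (a * (c * c) + b * (c * -s + -s * c) + d * (-s * -s)) +
      σ ^ 2 * (a * (s * s) + b * (s * c + c * s) + d * (c * c)) = σ ^ 2 * (a + d) := by
    linear_combination (σ ^ 2 * (a + d)) * hθ2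
  have e2 : σ ^ 2 * (a * (c * c) + b * (c * -s + -s * c) + d * (-s * -s)) *
      (σ ^ 2 * (a * (s * s) + b * (s * c + c * s) + d * (c * c))) -
      σ ^ 2 * (a * (c * s) + b * (c * c + -s * s) + d * (-s * c)) *
      (σ ^ 2 * (a * (s * c) + b * (s * -s + c * c) + d * (c * -s))) =
      σ ^ 4 * (a * d - b ^ 2) := by
    linear_combination (σ ^ 4 * (a * d - b ^ 2) * (c ^ 2 + s ^ 2 + 1)) * hθ2
  have e3 : σ ^ 2 * (a * (s * s) + b * (s * c + c * s) + d * (c * c)) * c ^ 2 -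
      (σ ^ 2 * (a * (c * s) + b * (c * c + -s * s) + d * (-s * c)) +
      σ ^ 2 * (a * (s * c) + b * (s * -s + c * c) + d * (c * -s))) * (c * s) +
      σ ^ 2 * (a * (c * c) + b * (c * -s + -s * c) + d * (-s * -s)) * s ^ 2 = σ ^ 2 * d := by
    linear_combination (σ ^ 2 * d * (c ^ 2 + s ^ 2 + 1)) * hθ2
  have e4 : σ ^ 2 * (a * (c * c) + b * (c * -s + -s * c) + d * (-s * -s)) * c ^ 2 +
      (σ ^ 2 * (a * (c * s) + b * (c * c + -s * s) + d * (-s * c)) +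
      σ ^ 2 * (a * (s * c) + b * (s * -s + c * c) + d * (c * -s))) * (c * s) +
      σ ^ 2 * (a * (s * s) + b * (s * c + c * s) + d * (c * c)) * s ^ 2 = σ ^ 2 * a := by
    linear_combination (σ ^ 2 * a * (c ^ 2 + s ^ 2 + 1)) * hθ2
  rw [e1, e2, e3, e4]
  have e5 : √((σ ^ 2 * (a + d)) ^ 2 - 4 * (σ ^ 4 * (a * d - b ^ 2))) =
      σ ^ 2 * √((a - d) ^ 2 + 4 * b ^ 2) := by
    rw [show (σ ^ 2 * (a + d)) ^ 2 - 4 * (σ ^ 4 * (a * d - b ^ 2)) =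
      (σ ^ 2) ^ 2 * ((a - d) ^ 2 + 4 * b ^ 2) by ring, Real.sqrt_mul (by positivity),
      Real.sqrt_sq (by positivity)]
  rw [e5]
  set D := √((a - d) ^ 2 + 4 * b ^ 2)
  have hσ' := hσ.ne'
  -- The top eigenvalue carries a factor `σ²`, which cancels in both products of the statistic.
  rw [show (σ ^ 2 * (a + d) + σ ^ 2 * D) / 2 = σ ^ 2 * ((a + d + D) / 2) by ring]
  generalize (a + d + D) / 2 = l
  rw [_root_.mul_inv (σ ^ 2) l, _root_.mul_inv (σ ^ 4)]
  field_simp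

/-! ### The statistic as a continuous function of a normalized sum -/

/-- The quadratic features of a bivariate observation which determine the sample covariance;
they are centred and orthonormal under the standard normal distribution. -/
def quadFeature (y : ℝ × ℝ) : EuclideanSpace ℝ (Fin 5) :=
  -- The halves normalize: `y₁² ± y₂²` has variance 4.
  !₂[y.1, y.2, (y.1 ^ 2 + y.2 ^ 2 - 2) / 2, (y.1 ^ 2 - y.2 ^ 2) / 2, y.1 * y.2]

/-- The first sample variance as a function of the normalized feature sum `u` and `ε = 1 / √n`. -/
def cov11 (u : EuclideanSpace ℝ (Fin 5)) (ε : ℝ) : ℝ := 1 + ε * (u 2 + u 3) - ε ^ 2 * u 0 ^ 2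

/-- The second sample variance as a function of the normalized feature sum and `ε = 1 / √n`. -/
def cov22 (u : EuclideanSpace ℝ (Fin 5)) (ε : ℝ) : ℝ := 1 + ε * (u 2 - u 3) - ε ^ 2 * u 1 ^ 2

/-- The sample covariance multiplied by `√n`, as a function of the normalized feature sum. -/
def rootCov12 (u : EuclideanSpace ℝ (Fin 5)) (ε : ℝ) : ℝ := u 4 - ε * (u 0 * u 1)

/-- The determinant of the standardized sample covariance matrix, where `e = (1 / √n, √n r v)`. -/
def covDet (p : EuclideanSpace ℝ (Fin 5) × ℝ × ℝ) : ℝ :=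
  (1 + p.2.1 * p.2.2) *
    (cov11 p.1 p.2.1 * cov22 p.1 p.2.1 - (p.2.1 * rootCov12 p.1 p.2.1) ^ 2)

/-- The difference of the two sample variances, multiplied by `√n`. -/
def rootDiff (p : EuclideanSpace ℝ (Fin 5) × ℝ × ℝ) : ℝ :=
  p.2.2 * cov11 p.1 p.2.1 + (2 * p.1 3 - p.2.1 * (p.1 0 ^ 2 - p.1 1 ^ 2))

/-- The difference of the two sample eigenvalues, multiplied by `√n`. -/
def rootGap (p : EuclideanSpace ℝ (Fin 5) × ℝ × ℝ) : ℝ :=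
  √(rootDiff p ^ 2 + 4 * ((1 + p.2.1 * p.2.2) * rootCov12 p.1 p.2.1 ^ 2))

/-- The Anderson statistic as a function of the normalized feature sum, with the denominator
truncated away from zero. -/
def truncatedAnderson (p : EuclideanSpace ℝ (Fin 5) × ℝ × ℝ) : ℝ :=
  rootGap p * (rootGap p - rootDiff p) / (2 * max (covDet p) (1 / 2))

theorem continuous_covDet : Continuous covDet := by
  unfold covDet cov11 cov22 rootCov12
  fun_prop

/-- The truncation secures continuity on the whole space, as the continuous mapping argument
requires. The threshold `1 / 2` may be any number strictly between 0 and the limiting determinant 1.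
-/
theorem continuous_truncatedAnderson : Continuous truncatedAnderson := by
  have h := continuous_covDet
  unfold truncatedAnderson rootGap rootDiff cov11 rootCov12
  refine Continuous.div (by fun_prop) (by fun_prop) fun p => ?_
  have : (0 : ℝ) < max (covDet p) (1 / 2) := lt_max_of_lt_right (by norm_num)
  positivity

/-- The normalized sum of the features. -/
def featureSum {n : ℕ} (y : Fin n → ℝ × ℝ) : EuclideanSpace ℝ (Fin 5) :=
  (√(n : ℝ))⁻¹ • ∑ i, quadFeature (y i)

theorem empCov_eq {n : ℕ} (hn : n ≠ 0) (a b : Fin n → ℝ) :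
    empCov a b = (n : ℝ)⁻¹ * ∑ i, a i * b i -
      ((n : ℝ)⁻¹ * ∑ i, a i) * ((n : ℝ)⁻¹ * ∑ i, b i) := by
  have hn' : (n : ℝ) ≠ 0 := by positivity
  unfold empCov
  set p := (n : ℝ)⁻¹ * ∑ l, a l with hp
  set q := (n : ℝ)⁻¹ * ∑ l, b l with hq
  have h1 : ∑ i, a i = n * p := by rw [hp]; field_simp
  have h2 : ∑ i, b i = n * q := by rw [hq]; field_simp
  have : ∑ i, (a i - p) * (b i - q) = ∑ i, a i * b i - n * p * q := by
    have : ∀ i, (a i - p) * (b i - q) = a i * b i - a i * q - p * b i + p * q := fun i => by ring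
    simp only [this, Finset.sum_add_distrib, Finset.sum_sub_distrib, ← Finset.mul_sum,
      ← Finset.sum_mul, h1, h2]
    simp
  rw [this]
  field_simp

theorem andersonStat_eq_truncatedAnderson {n : ℕ} (hn : n ≠ 0) (m : EuclideanSpace ℝ (Fin 2))
    {σ c : ℝ} (hσ : 0 < σ) (hc : 0 ≤ c) {θ : EuclideanSpace ℝ (Fin 2)} (hθ : ‖θ‖ = 1)
    (y : Fin n → ℝ × ℝ)
    (hdet : 1 / 2 ≤ covDet (featureSum y, (√(n : ℝ))⁻¹, √(n : ℝ) * c)) :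
    andersonStat θ (fun i => spikedMap m σ (1 + c) θ (y i)) =
      truncatedAnderson (featureSum y, (√(n : ℝ))⁻¹, √(n : ℝ) * c) := by
  have hs0 : √(n : ℝ) ≠ 0 := by positivity
  have hsq : √(n : ℝ) ^ 2 = n := Real.sq_sqrt (by positivity)
  set s := √(n : ℝ) with hs
  have hu : ∀ j, featureSum y j = s⁻¹ * ∑ i, quadFeature (y i) j := by
    intro j
    simp [featureSum, hs]
  have u0 : featureSum y 0 = s⁻¹ * ∑ i, (y i).1 := hu 0
  have u1 : featureSum y 1 = s⁻¹ * ∑ i, (y i).2 := hu 1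
  have u2 : featureSum y 2 = s⁻¹ * ((∑ i, (y i).1 * (y i).1 + ∑ i, (y i).2 * (y i).2) / 2 - n) := by
    rw [hu 2, ← Finset.sum_add_distrib]
    congr 1
    change ∑ i, ((y i).1 ^ 2 + (y i).2 ^ 2 - 2) / 2 = _
    rw [← Finset.sum_div, Finset.sum_sub_distrib, sub_div]
    simp [pow_two]
  have u3 : featureSum y 3 = s⁻¹ * ((∑ i, (y i).1 * (y i).1 - ∑ i, (y i).2 * (y i).2) / 2) := by
    rw [hu 3, ← Finset.sum_sub_distrib, Finset.sum_div]
    congr 1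
    refine Finset.sum_congr rfl fun i _ => ?_
    change ((y i).1 ^ 2 - (y i).2 ^ 2) / 2 = _
    ring
  have u4 : featureSum y 4 = s⁻¹ * ∑ i, (y i).1 * (y i).2 := hu 4
  have hc11 : empCov (fun i => (y i).1) (fun i => (y i).1) = cov11 (featureSum y) s⁻¹ := by
    rw [empCov_eq hn, cov11, u0, u2, u3, ← hsq]
    field_simp
    ring
  have hc22 : empCov (fun i => (y i).2) (fun i => (y i).2) = cov22 (featureSum y) s⁻¹ := by
    rw [empCov_eq hn, cov22, u1, u2, u3, ← hsq]
    field_simp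
    ring
  have hc12 : empCov (fun i => (y i).1) (fun i => (y i).2) =
      s⁻¹ * rootCov12 (featureSum y) s⁻¹ := by
    rw [empCov_eq hn, rootCov12, u0, u1, u4, ← hsq]
    field_simp
  have hroot : √(1 + c) ^ 2 = 1 + c := Real.sq_sqrt (by linarith)
  have hsc : s⁻¹ * (s * c) = c := by field_simp
  have hD : (1 + c) * cov11 (featureSum y) s⁻¹ * cov22 (featureSum y) s⁻¹ -
      (√(1 + c) * (s⁻¹ * rootCov12 (featureSum y) s⁻¹)) ^ 2 =
      covDet (featureSum y, s⁻¹, s * c) := by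
    simp only [covDet, hsc]
    linear_combination (-(s⁻¹ * rootCov12 (featureSum y) s⁻¹) ^ 2) * hroot
  have hdiff : (1 + c) * cov11 (featureSum y) s⁻¹ - cov22 (featureSum y) s⁻¹ =
      s⁻¹ * rootDiff (featureSum y, s⁻¹, s * c) := by
    simp only [rootDiff, cov11, cov22]
    field_simp
    ring
  rw [andersonStat_spikedMap m hσ (by linarith) hθ y rfl rfl rfl
    (by rw [hc11, hc12, hc22, hD]; linarith), hc11, hc12, hc22, hD, hdiff]
  have hgap : √((s⁻¹ * rootDiff (featureSum y, s⁻¹, s * c)) ^ 2 +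
      4 * (√(1 + c) * (s⁻¹ * rootCov12 (featureSum y) s⁻¹)) ^ 2) =
      s⁻¹ * rootGap (featureSum y, s⁻¹, s * c) := by
    rw [rootGap, show (s⁻¹ * rootDiff (featureSum y, s⁻¹, s * c)) ^ 2 +
      4 * (√(1 + c) * (s⁻¹ * rootCov12 (featureSum y) s⁻¹)) ^ 2 =
      s⁻¹ ^ 2 * (rootDiff (featureSum y, s⁻¹, s * c) ^ 2 +
        4 * ((1 + c) * rootCov12 (featureSum y) s⁻¹ ^ 2)) by
      linear_combination (4 * (s⁻¹ * rootCov12 (featureSum y) s⁻¹) ^ 2) * hroot,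
      Real.sqrt_mul (by positivity), Real.sqrt_sq (by positivity)]
    simp only [hsc]
  rw [hgap, truncatedAnderson, max_eq_left hdet]
  -- The prefactor `n = s²` absorbs the factors `s⁻¹` of the gap and of the difference.
  nth_rewrite 1 [← hsq]
  field_simp

end

/-! ### Multivariate central limit theorem -/

open scoped RealInnerProductSpace in
/-- **Multivariate central limit theorem** for centred i.i.d. vectors with identity covariance. -/
theorem tendstoInDistribution_inv_sqrt_smul_sum {E Ω Ω' : Type*} [NormedAddCommGroup E]
    [InnerProductSpace ℝ E] [FiniteDimensional ℝ E] [MeasurableSpace E] [BorelSpace E]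
    {mΩ : MeasurableSpace Ω} {mΩ' : MeasurableSpace Ω'} {P : Measure Ω} {P' : Measure Ω'}
    [IsProbabilityMeasure P] [IsProbabilityMeasure P'] {X : ℕ → Ω → E} {Y : Ω' → E}
    (hY : HasLaw Y (stdGaussian E) P')
    (h0 : ∀ t : E, ∫ ω, ⟪X 0 ω, t⟫ ∂P = 0)
    (h1 : ∀ t : E, ∫ ω, ⟪X 0 ω, t⟫ ^ 2 ∂P = ‖t‖ ^ 2)
    (hindep : iIndepFun X P) (hident : ∀ i, IdentDistrib (X i) (X 0) P P) :
    TendstoInDistribution (fun (n : ℕ) ω => (√(n : ℝ))⁻¹ • ∑ k ∈ Finset.range n, X k ω) atTop Y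
      (fun _ => P) P' where
  forall_aemeasurable n :=
    .const_smul (Finset.aemeasurable_fun_sum _ fun _ _ => (hident _).aemeasurable_fst) _
  aemeasurable_limit := hY.aemeasurable
  tendsto := by
    refine ProbabilityMeasure.tendsto_iff_tendsto_charFun.2 fun t => ?_
    have hmeas : ∀ n : ℕ,
        AEMeasurable (fun ω => (√(n : ℝ))⁻¹ • ∑ k ∈ Finset.range n, X k ω) P := fun n =>
      .const_smul (Finset.aemeasurable_fun_sum _ fun _ _ => (hident _).aemeasurable_fst) _
    simp only [ProbabilityMeasure.coe_mk, hY.map_eq, charFun_stdGaussian]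
    rcases eq_or_ne t 0 with rfl | ht
    · have : ∀ n : ℕ, IsProbabilityMeasure
          (P.map fun ω => (√(n : ℝ))⁻¹ • ∑ k ∈ Finset.range n, X k ω) := fun n =>
        Measure.isProbabilityMeasure_map (hmeas n)
      simp
    have ht' : ‖t‖ ≠ 0 := by simpa using ht
    -- Cramér–Wold: the characteristic function at `t` is that of the projection on the unit vector
    -- `e`, taken at `‖t‖`.
    set e : E := ‖t‖⁻¹ • t with he
    have hte : t = ‖t‖ • e := by rw [he, smul_smul, mul_inv_cancel₀ ht', one_smul]
    have hnorm : ‖e‖ = 1 := by rw [he, norm_smul, norm_inv, norm_norm, inv_mul_cancel₀ ht']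
    have hinner : Measurable fun x : E => ⟪x, e⟫ := by fun_prop
    have hlim₀ := tendstoInDistribution_inv_sqrt_mul_sum (P := P) (P' := gaussianReal 0 1)
      (X := fun k ω => ⟪X k ω, e⟫) (Y := id) HasLaw.id (h0 e)
      (by simpa [hnorm] using h1 e) (hindep.comp (fun _ x => ⟪x, e⟫) fun _ => hinner)
      (fun i => (hident i).comp hinner)
    have hlim' := hlim₀.forall_aemeasurable
    have hlim := hlim₀.tendsto
    have hchar := ProbabilityMeasure.tendsto_iff_tendsto_charFun.1 hlim ‖t‖
    simp only [ProbabilityMeasure.coe_mk, Measure.map_id, charFun_gaussianReal] at hchar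
    convert! hchar using 2 with n
    · rw [charFun_apply, charFun_apply_real, integral_map (hmeas n) (by fun_prop),
        integral_map (hlim' n) (by fun_prop)]
      refine integral_congr_ae (ae_of_all _ fun ω => ?_)
      simp only []
      congr 2
      nth_rewrite 1 [hte]
      rw [real_inner_smul_right, real_inner_smul_left, sum_inner]
      push_cast
      ring
    · simp
      ring_nf

/-! ### Gaussian moments and orthonormality of the features -/

/-- The first four derivatives at zero of the moment generating function give the moments of the
standard normal distribution. -/
theorem integral_pow_gaussianReal (a : Fin 5) :
    ∫ x, x ^ (a : ℕ) ∂gaussianReal 0 1 = (![1, 0, 1, 0, 3] : Fin 5 → ℝ) a := by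
  have h0 : mgf (fun x => x) (gaussianReal 0 1) = fun t => 1 * Real.exp (t ^ 2 / 2) := by
    rw [mgf_fun_id_gaussianReal]; simp
  have key : ∀ (f f' : ℝ → ℝ), (∀ t, HasDerivAt f (f' t) t) →
      deriv (fun t => f t * Real.exp (t ^ 2 / 2)) =
        fun t => (f' t + t * f t) * Real.exp (t ^ 2 / 2) := by
    intro f f' hf
    ext t
    have h2 : HasDerivAt (fun t : ℝ => Real.exp (t ^ 2 / 2)) (Real.exp (t ^ 2 / 2) * t) t := by
      have := (((hasDerivAt_id t).pow 2).div_const 2).exp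
      simpa using this
    refine ((hf t).mul h2).deriv.trans ?_
    ring
  -- Each polynomial is kept in the unsimplified form produced by the preceding derivative, so that
  -- the rewrites chain syntactically.
  have d1 := key (fun _ => 1) (fun _ => 0) fun t => hasDerivAt_const t 1
  have d2 := key (fun t => 0 + t * 1) (fun _ => 1) fun t => by
    simpa using hasDerivAt_id' t
  have d3 := key (fun t => 1 + t * (0 + t * 1)) (fun t => 2 * t) fun t => by
    simpa [← pow_two] using (hasDerivAt_pow 2 t).const_add 1
  have d4 := key (fun t => 2 * t + t * (1 + t * (0 + t * 1))) (fun t => 3 + 3 * t ^ 2) fun t => by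
    have := ((hasDerivAt_id t).const_mul 3).add (hasDerivAt_pow 3 t)
    convert! this using 1
    · ext t; simp; ring
    · simp
  have hm := iteratedDeriv_mgf_zero (X := fun x : ℝ => x) (μ := gaussianReal 0 1)
    (by simp) (a : ℕ)
  simp only [Pi.pow_apply] at hm
  rw [← hm, h0]
  fin_cases a <;>
    simp only [iteratedDeriv_succ, iteratedDeriv_zero, d1, d2, d3, d4] <;> simp

theorem integrable_pow_gaussianReal (n : ℕ) : Integrable (fun x => x ^ n) (gaussianReal 0 1) := by
  have h := (memLp_id_gaussianReal (μ := 0) (v := 1) n).integrable_norm_pow'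
  exact h.mono' (by fun_prop) (ae_of_all _ fun x => by simp)

/-- The integral of a bivariate polynomial of degree at most four in each variable under the
standard normal distribution. -/
theorem integral_polynomial_gaussian (c : Fin 5 → Fin 5 → ℝ) :
    ∫ y : ℝ × ℝ, ∑ a : Fin 5, ∑ b : Fin 5, c a b * (y.1 ^ (a : ℕ) * y.2 ^ (b : ℕ))
      ∂(gaussianReal 0 1).prod (gaussianReal 0 1) =
    ∑ a : Fin 5, ∑ b : Fin 5, c a b * ((![1, 0, 1, 0, 3] : Fin 5 → ℝ) a *
      (![1, 0, 1, 0, 3] : Fin 5 → ℝ) b) := by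
  have hint : ∀ a b : Fin 5, Integrable
      (fun y : ℝ × ℝ => c a b * (y.1 ^ (a : ℕ) * y.2 ^ (b : ℕ)))
      ((gaussianReal 0 1).prod (gaussianReal 0 1)) := fun a b =>
    ((integrable_pow_gaussianReal a).mul_prod (integrable_pow_gaussianReal b)).const_mul _
  rw [integral_finsetSum _ fun a _ => integrable_finsetSum _ fun b _ => hint a b]
  refine Finset.sum_congr rfl fun a _ => ?_
  rw [integral_finsetSum _ fun b _ => hint a b]
  refine Finset.sum_congr rfl fun b _ => ?_
  rw [integral_const_mul, integral_prod_mul (fun x : ℝ => x ^ (a : ℕ)) (fun x : ℝ => x ^ (b : ℕ)),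
    integral_pow_gaussianReal, integral_pow_gaussianReal]

open scoped RealInnerProductSpace in
theorem inner_quadFeature (y : ℝ × ℝ) (t : EuclideanSpace ℝ (Fin 5)) :
    ⟪quadFeature y, t⟫ = t 0 * y.1 + t 1 * y.2 + t 2 * ((y.1 ^ 2 + y.2 ^ 2 - 2) / 2) +
      t 3 * ((y.1 ^ 2 - y.2 ^ 2) / 2) + t 4 * (y.1 * y.2) := by
  simp [quadFeature, PiLp.inner_apply, Fin.sum_univ_five]

open scoped RealInnerProductSpace in
theorem integral_inner_quadFeature (t : EuclideanSpace ℝ (Fin 5)) :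
    ∫ y, ⟪quadFeature y, t⟫ ∂(gaussianReal 0 1).prod (gaussianReal 0 1) = 0 := by
  -- Entry `(a, b)` is the coefficient of `y₁ᵃ y₂ᵇ` in the expanded integrand.
  have h := integral_polynomial_gaussian
    ![![-t 2, t 1, (t 2 - t 3) / 2, 0, 0], ![t 0, t 4, 0, 0, 0], ![(t 2 + t 3) / 2, 0, 0, 0, 0],
      0, 0]
  simp [Fin.sum_univ_five] at h
  refine Eq.trans (integral_congr_ae (ae_of_all _ fun y => ?_)) (h.trans ?_)
  · simp only [inner_quadFeature]
    ring
  · ring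

open scoped RealInnerProductSpace in
theorem integral_inner_quadFeature_sq (t : EuclideanSpace ℝ (Fin 5)) :
    ∫ y, ⟪quadFeature y, t⟫ ^ 2 ∂(gaussianReal 0 1).prod (gaussianReal 0 1) = ‖t‖ ^ 2 := by
  have h := integral_polynomial_gaussian
    ![![t 2 ^ 2, -2 * t 2 * t 1, t 1 ^ 2 - t 2 * (t 2 - t 3), t 1 * (t 2 - t 3),
        ((t 2 - t 3) / 2) ^ 2],
      ![-2 * t 2 * t 0, 2 * t 0 * t 1 - 2 * t 2 * t 4, t 0 * (t 2 - t 3) + 2 * t 1 * t 4,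
        (t 2 - t 3) * t 4, 0],
      ![t 0 ^ 2 - t 2 * (t 2 + t 3), 2 * t 0 * t 4 + t 1 * (t 2 + t 3),
        (t 2 + t 3) * (t 2 - t 3) / 2 + t 4 ^ 2, 0, 0],
      ![t 0 * (t 2 + t 3), (t 2 + t 3) * t 4, 0, 0, 0],
      ![((t 2 + t 3) / 2) ^ 2, 0, 0, 0, 0]]
  simp [Fin.sum_univ_five] at h
  refine Eq.trans (integral_congr_ae (ae_of_all _ fun y => ?_)) (h.trans ?_)
  · simp only [inner_quadFeature]
    ring
  · rw [EuclideanSpace.real_norm_sq_eq, Fin.sum_univ_five]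
    ring

/-! ### The limit law, by polar coordinates -/

open scoped ENNReal NNReal Real in
/-- Integration against the standard normal distribution of the plane in polar coordinates. -/
theorem lintegral_gaussian_prod_polar {g : ℝ × ℝ → ℝ≥0∞} (hg : Measurable g) :
    ∫⁻ z, g z ∂(gaussianReal 0 1).prod (gaussianReal 0 1) =
      ∫⁻ r in Set.Ioi (0 : ℝ), ENNReal.ofReal (r * ((2 * π)⁻¹ * Real.exp (-r ^ 2 / 2))) *
        ∫⁻ φ in Set.Ioo (-π) π, g (r * Real.cos φ, r * Real.sin φ) := by
  have hpdf : ∀ r φ : ℝ, gaussianPDF 0 1 (r * Real.cos φ) * gaussianPDF 0 1 (r * Real.sin φ) =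
      ENNReal.ofReal ((2 * π)⁻¹ * Real.exp (-r ^ 2 / 2)) := by
    intro r φ
    rw [gaussianPDF, gaussianPDF, ← ENNReal.ofReal_mul (gaussianPDFReal_nonneg _ _ _)]
    congr 1
    simp only [gaussianPDFReal, NNReal.coe_one, mul_one, sub_zero]
    rw [mul_mul_mul_comm, ← Real.exp_add, ← _root_.mul_inv, Real.mul_self_sqrt (by positivity)]
    congr 2
    linear_combination (-r ^ 2 / 2) * Real.sin_sq_add_cos_sq φ
  rw [gaussianReal_of_var_ne_zero 0 one_ne_zero,
    prod_withDensity (measurable_gaussianPDF 0 1) (measurable_gaussianPDF 0 1),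
    lintegral_withDensity_eq_lintegral_mul _ (by fun_prop) hg, ← Measure.volume_eq_prod,
    ← lintegral_comp_polarCoord_symm, polarCoord_target, Measure.volume_eq_prod,
    ← Measure.prod_restrict, lintegral_prod _ (by
      simp only [polarCoord_symm_apply]
      fun_prop)]
  refine setLIntegral_congr_fun measurableSet_Ioi fun r hr => ?_
  simp only [polarCoord_symm_apply, Pi.mul_apply, hpdf, smul_eq_mul]
  rw [← lintegral_const_mul _ (by fun_prop)]
  refine lintegral_congr fun φ => ?_
  rw [← mul_assoc, ← ENNReal.ofReal_mul (le_of_lt hr)]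

open scoped Real in
/-- Halving the argument does not change the integral of a `π`-periodic function over `(-π, π)`. -/
theorem integral_comp_half_of_periodic {k : ℝ → ℝ} (hk : Continuous k)
    (hper : Function.Periodic k π) :
    ∫ φ in (-π)..π, k (φ / 2) = ∫ φ in (-π)..π, k φ := by
  -- `(-π, 0)`, `(0, π)` and `(-π/2, π/2)` are each one full period.
  have h1 : ∫ φ in (-π)..0, k φ = ∫ φ in (-π / 2)..(π / 2), k φ := by
    have := hper.intervalIntegral_add_eq (-π) (-π / 2)
    rw [neg_add_cancel, show -π / 2 + π = π / 2 by ring] at this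
    exact this
  have h2 : ∫ φ in (0)..π, k φ = ∫ φ in (-π / 2)..(π / 2), k φ := by
    have := hper.intervalIntegral_add_eq 0 (-π / 2)
    rw [zero_add, show -π / 2 + π = π / 2 by ring] at this
    exact this
  rw [intervalIntegral.integral_comp_div _ two_ne_zero,
    ← intervalIntegral.integral_add_adjacent_intervals (hk.intervalIntegrable (-π) 0)
      (hk.intervalIntegrable 0 π), h1, h2, smul_eq_mul, two_mul]

open scoped Real NNReal in
/-- For a standard normal vector `z` of the plane, `2 ‖z‖ (‖z‖ - z₁)` is distributed as
`4 z₂²`. -/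
theorem map_gaussian_prod_norm_mul_norm_sub :
    ((gaussianReal 0 1).prod (gaussianReal 0 1)).map
        (fun z : ℝ × ℝ => 2 * (√(z.1 ^ 2 + z.2 ^ 2) * (√(z.1 ^ 2 + z.2 ^ 2) - z.1))) =
      ((gaussianReal 0 1).prod (gaussianReal 0 1)).map (fun z : ℝ × ℝ => 4 * z.2 ^ 2) := by
  refine ext_of_forall_lintegral_eq_of_IsFiniteMeasure fun f => ?_
  have hf : Measurable fun x => (f x : ENNReal) := by fun_prop
  rw [lintegral_map hf (by fun_prop), lintegral_map hf (by fun_prop),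
    lintegral_gaussian_prod_polar (by fun_prop), lintegral_gaussian_prod_polar (by fun_prop)]
  -- The radial weights agree, so it suffices to compare the angular integrals at fixed `r`.
  refine setLIntegral_congr_fun measurableSet_Ioi fun r hr => ?_
  simp only []
  congr 1
  have hr : 0 < r := hr
  set k : ℝ → ℝ := fun φ => f (4 * (r * Real.sin φ) ^ 2) with hk
  have hkc : Continuous k := by fun_prop
  have hkper : Function.Periodic k π := fun φ => by simp [hk, Real.sin_add_pi]
  have hpi : -π ≤ π := by linarith [Real.pi_pos]
  have hconv : ∀ q : ℝ → ℝ≥0, Continuous q →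
      ∫⁻ φ in Set.Ioo (-π) π, (q φ : ENNReal) =
        ENNReal.ofReal (∫ φ in (-π)..π, (q φ : ℝ)) := by
    intro q hq
    rw [intervalIntegral.integral_of_le hpi, integral_Ioc_eq_integral_Ioo,
      ofReal_integral_eq_lintegral_ofReal]
    · simp
    · exact ((NNReal.continuous_coe.comp hq).integrableOn_Icc).mono_set Set.Ioo_subset_Icc_self
    · exact ae_of_all _ fun φ => NNReal.coe_nonneg _
  -- Half-angle formula `1 - cos φ = 2 sin²(φ/2)`.
  have hangle : ∀ φ : ℝ, 2 * (√((r * Real.cos φ) ^ 2 + (r * Real.sin φ) ^ 2) *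
      (√((r * Real.cos φ) ^ 2 + (r * Real.sin φ) ^ 2) - r * Real.cos φ)) =
      4 * (r * Real.sin (φ / 2)) ^ 2 := by
    intro φ
    rw [show (r * Real.cos φ) ^ 2 + (r * Real.sin φ) ^ 2 = r ^ 2 by
      linear_combination r ^ 2 * Real.sin_sq_add_cos_sq φ, Real.sqrt_sq hr.le, mul_pow,
      Real.sin_sq_eq_half_sub]
    rw [show 2 * (φ / 2) = φ by ring]
    ring
  simp only [hangle]
  rw [hconv (fun φ => f (4 * (r * Real.sin (φ / 2)) ^ 2)) (by fun_prop),
    hconv (fun φ => f (4 * (r * Real.sin φ) ^ 2)) (by fun_prop)]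
  exact congrArg _ (integral_comp_half_of_periodic hkc hkper)

theorem chiSquare_one : chiSquare 1 = (gaussianReal 0 1).map (fun x => x ^ 2) := by
  have h : MeasurePreserving (Function.eval (0 : Fin 1))
      (Measure.pi fun _ : Fin 1 => gaussianReal 0 1) (gaussianReal 0 1) :=
    measurePreserving_eval _ 0
  conv_rhs => rw [← h.map_eq, Measure.map_map (by fun_prop) (by fun_prop)]
  simp [chiSquare, Function.comp_def]

/-- The limit law of the Anderson statistic. -/
theorem map_truncatedAnderson_stdGaussian :
    (stdGaussian (EuclideanSpace ℝ (Fin 5))).map (fun u => truncatedAnderson (u, 0, 0)) =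
      (chiSquare 1).map (fun z => 4 * z) := by
  have hpair : (stdGaussian (EuclideanSpace ℝ (Fin 5))).map (fun u => (u 3, u 4)) =
      (gaussianReal 0 1).prod (gaussianReal 0 1) := by
    have hind := iIndepFun_pi (μ := fun _ : Fin 5 => gaussianReal 0 1) (X := fun _ x => x)
      fun _ => aemeasurable_id
    have h34 := (indepFun_iff_map_prod_eq_prod_map_map (measurable_pi_apply 3).aemeasurable
      (measurable_pi_apply 4).aemeasurable).1
      (hind.indepFun (show (3 : Fin 5) ≠ 4 by decide))
    rw [← map_pi_eq_stdGaussian, Measure.map_map (by fun_prop) (by fun_prop)]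
    refine h34.trans ?_
    rw [(measurePreserving_eval (fun _ : Fin 5 => gaussianReal 0 1) 3).map_eq,
      (measurePreserving_eval (fun _ : Fin 5 => gaussianReal 0 1) 4).map_eq]
  have hfun : (fun u : EuclideanSpace ℝ (Fin 5) => truncatedAnderson (u, 0, 0)) =
      (fun z : ℝ × ℝ => 2 * (√(z.1 ^ 2 + z.2 ^ 2) * (√(z.1 ^ 2 + z.2 ^ 2) - z.1))) ∘
        fun u => (u 3, u 4) := by
    ext u
    have hgap : √((2 * u 3) ^ 2 + 4 * u 4 ^ 2) = 2 * √(u 3 ^ 2 + u 4 ^ 2) := by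
      rw [show (2 * u 3) ^ 2 + 4 * u 4 ^ 2 = 2 ^ 2 * (u 3 ^ 2 + u 4 ^ 2) by ring,
        Real.sqrt_mul (by positivity), Real.sqrt_sq (by positivity)]
    have hmax : max (1 : ℝ) 2⁻¹ = 1 := max_eq_left (by norm_num)
    simp [truncatedAnderson, rootGap, rootDiff, covDet, cov11, cov22, rootCov12, hgap, hmax]
    ring
  rw [hfun, ← Measure.map_map (by fun_prop) (by fun_prop), hpair,
    map_gaussian_prod_norm_mul_norm_sub, chiSquare_one, Measure.map_map (by fun_prop) (by fun_prop)]
  conv_rhs => rw [← (measurePreserving_snd (μ := gaussianReal 0 1) (ν := gaussianReal 0 1)).map_eq,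
    Measure.map_map (by fun_prop) (by fun_prop)]
  rfl

/-! ### Representation of the spiked normal law -/

open scoped RealInnerProductSpace in
theorem sq_inner_add_sq_inner_rotateRight {θ : EuclideanSpace ℝ (Fin 2)} (hθ : ‖θ‖ = 1)
    (s : EuclideanSpace ℝ (Fin 2)) :
    ⟪θ, s⟫ ^ 2 + ⟪rotateRight θ, s⟫ ^ 2 = s 0 ^ 2 + s 1 ^ 2 := by
  have hθ2 : θ 0 ^ 2 + θ 1 ^ 2 = 1 := by
    have h := EuclideanSpace.real_norm_sq_eq θ
    rw [hθ, Fin.sum_univ_two] at h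
    linarith
  simp only [PiLp.inner_apply, Fin.sum_univ_two, rotateRight]
  simp
  linear_combination (s 0 ^ 2 + s 1 ^ 2) * hθ2

theorem posSemidef_spikedCov (σ : ℝ) {r v : ℝ} (hrv : 0 ≤ r * v)
    (θ : EuclideanSpace ℝ (Fin 2)) : (spikedCov σ r v θ).PosSemidef := by
  refine (Matrix.PosSemidef.one.add (Matrix.PosSemidef.smul ?_ hrv)).smul (sq_nonneg σ)
  simpa using Matrix.posSemidef_vecMulVec_self_star (fun i => θ i)

theorem measurable_spikedMap (m : EuclideanSpace ℝ (Fin 2)) (σ t : ℝ)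
    (θ : EuclideanSpace ℝ (Fin 2)) : Measurable (spikedMap m σ t θ) := by
  unfold spikedMap
  fun_prop

-- The characteristic functions agree because the identity is the sum of the projections on `θ` and
-- `rotateRight θ`, so the spike only multiplies the variance along `θ` by `1 + r v`.
open scoped RealInnerProductSpace in
theorem map_spikedMap_gaussian (m : EuclideanSpace ℝ (Fin 2)) (σ : ℝ) {r v : ℝ}
    (hrv : 0 ≤ r * v) {θ : EuclideanSpace ℝ (Fin 2)} (hθ : ‖θ‖ = 1) :
    ((gaussianReal 0 1).prod (gaussianReal 0 1)).map (spikedMap m σ (1 + r * v) θ) =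
      multivariateGaussian m (spikedCov σ r v θ) := by
  have hm := measurable_spikedMap m σ (1 + r * v) θ
  have : IsProbabilityMeasure (((gaussianReal 0 1).prod (gaussianReal 0 1)).map
      (spikedMap m σ (1 + r * v) θ)) := Measure.isProbabilityMeasure_map hm.aemeasurable
  refine Measure.ext_of_charFun (funext fun s => ?_)
  rw [charFun_multivariateGaussian (posSemidef_spikedCov σ hrv θ), charFun_apply,
    integral_map hm.aemeasurable (by fun_prop)]
  have hsplit : ∀ y : ℝ × ℝ, Complex.exp (⟪spikedMap m σ (1 + r * v) θ y, s⟫ * Complex.I) =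
      Complex.exp (⟪s, m⟫ * Complex.I) *
        (Complex.exp ((σ * √(1 + r * v) * ⟪θ, s⟫ : ℝ) * y.1 * Complex.I) *
          Complex.exp ((σ * ⟪rotateRight θ, s⟫ : ℝ) * y.2 * Complex.I)) := by
    intro y
    rw [← Complex.exp_add, ← Complex.exp_add, spikedMap, inner_add_left, real_inner_smul_left,
      inner_add_left, real_inner_smul_left, real_inner_smul_left, real_inner_comm s m]
    congr 1
    push_cast
    ring
  simp only [hsplit]
  rw [integral_const_mul, integral_prod_mul
    (fun x : ℝ => Complex.exp ((σ * √(1 + r * v) * ⟪θ, s⟫ : ℝ) * x * Complex.I))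
    (fun x : ℝ => Complex.exp ((σ * ⟪rotateRight θ, s⟫ : ℝ) * x * Complex.I)),
    ← charFun_apply_real, ← charFun_apply_real, charFun_gaussianReal, charFun_gaussianReal,
    ← Complex.exp_add, ← Complex.exp_add]
  have hquad : (s : Fin 2 → ℝ) ⬝ᵥ spikedCov σ r v θ *ᵥ s =
      (σ * √(1 + r * v) * ⟪θ, s⟫) ^ 2 + (σ * ⟪rotateRight θ, s⟫) ^ 2 := by
    have hroot : √(1 + r * v) ^ 2 = 1 + r * v := Real.sq_sqrt (by linarith)
    have hinner : ⟪θ, s⟫ = θ 0 * s 0 + θ 1 * s 1 := by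
      simp [PiLp.inner_apply, Fin.sum_univ_two, mul_comm]
    have h1 : (s : Fin 2 → ℝ) ⬝ᵥ spikedCov σ r v θ *ᵥ s =
        σ ^ 2 * (s 0 ^ 2 + s 1 ^ 2 + r * v * ⟪θ, s⟫ ^ 2) := by
      rw [hinner]
      simp [spikedCov, Matrix.mulVec, dotProduct, Fin.sum_univ_two, vecMulVec_apply]
      ring
    rw [h1]
    linear_combination (-σ ^ 2) * sq_inner_add_sq_inner_rotateRight hθ s -
      (σ ^ 2 * ⟪θ, s⟫ ^ 2) * hroot
  rw [hquad]
  congr 1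
  push_cast
  simp
  ring

/-! ### Convergence for the canonical sample -/

/-- The law of an i.i.d. sequence of standard normal pairs. -/
noncomputable def gaussianPairs : Measure (ℕ → ℝ × ℝ) :=
  Measure.infinitePi fun _ => (gaussianReal 0 1).prod (gaussianReal 0 1)

instance gaussianPairs_isProbabilityMeasure : IsProbabilityMeasure gaussianPairs := by
  unfold gaussianPairs
  infer_instance

theorem iIndepFun_gaussianPairs :
    iIndepFun (fun (i : ℕ) (ω : ℕ → ℝ × ℝ) => ω i) gaussianPairs :=
  iIndepFun_infinitePi (X := fun _ x => x) fun _ => measurable_id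

theorem hasLaw_gaussianPairs (i : ℕ) :
    HasLaw (fun ω : ℕ → ℝ × ℝ => ω i) ((gaussianReal 0 1).prod (gaussianReal 0 1))
      gaussianPairs :=
  (measurePreserving_eval_infinitePi
    (fun _ : ℕ => (gaussianReal 0 1).prod (gaussianReal 0 1)) i).hasLaw

theorem measurable_quadFeature : Measurable quadFeature := by
  unfold quadFeature
  refine (WithLp.measurable_toLp 2 _).comp (measurable_pi_iff.2 fun i => ?_)
  fin_cases i <;> simp <;> fun_prop

theorem tendstoInDistribution_featureSum :
    TendstoInDistribution (fun (n : ℕ) (ω : ℕ → ℝ × ℝ) => featureSum fun i : Fin n => ω i) atTop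
      (fun u => u) (fun _ => gaussianPairs) (stdGaussian (EuclideanSpace ℝ (Fin 5))) := by
  have hlaw := hasLaw_gaussianPairs
  have h := tendstoInDistribution_inv_sqrt_smul_sum (P := gaussianPairs)
    (X := fun k ω => quadFeature (ω k))
    (HasLaw.id (μ := stdGaussian (EuclideanSpace ℝ (Fin 5))))
    (fun t => ((hlaw 0).integral_comp
      ((measurable_quadFeature.inner_const (c := t)).aestronglyMeasurable)).trans
      (integral_inner_quadFeature t))
    (fun t => ((hlaw 0).integral_comp
      (((measurable_quadFeature.inner_const (c := t)).pow_const 2).aestronglyMeasurable)).trans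
      (integral_inner_quadFeature_sq t))
    (iIndepFun_gaussianPairs.comp _ fun _ => measurable_quadFeature)
    (fun i => (IdentDistrib.mk (f := fun ω : ℕ → ℝ × ℝ => ω i) (g := fun ω : ℕ → ℝ × ℝ => ω 0)
      (hlaw i).aemeasurable (hlaw 0).aemeasurable
      ((hlaw i).map_eq.trans (hlaw 0).map_eq.symm)).comp measurable_quadFeature)
  simpa only [featureSum, Finset.sum_range] using! h

/-- The Anderson statistic of the canonical Gaussian sample converges in distribution. -/
theorem tendstoInDistribution_andersonStat_spikedMap {θ : EuclideanSpace ℝ (Fin 2)}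
    (hθ : ‖θ‖ = 1) {c : ℕ → ℝ} (hc : ∀ n, 0 ≤ c n)
    (hc_lim : Tendsto (fun n : ℕ => √(n : ℝ) * c n) atTop (𝓝 0))
    (m : ℕ → EuclideanSpace ℝ (Fin 2)) {σ : ℕ → ℝ} (hσ : ∀ n, 0 < σ n) :
    TendstoInDistribution (fun (n : ℕ) (ω : ℕ → ℝ × ℝ) =>
        andersonStat θ fun i : Fin n => spikedMap (m n) (σ n) (1 + c n) θ (ω i)) atTop
      (fun u => truncatedAnderson (u, 0, 0)) (fun _ => gaussianPairs)
      (stdGaussian (EuclideanSpace ℝ (Fin 5))) := by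
  -- These parameters are deterministic and tend to 0, the second by the weak-spike assumption, so
  -- they join the central limit theorem by Slutsky's lemma.
  set e : ℕ → ℝ × ℝ := fun n => ((√(n : ℝ))⁻¹, √(n : ℝ) * c n) with he
  have he_lim : Tendsto e atTop (𝓝 ((0 : ℝ), (0 : ℝ))) :=
    (tendsto_inv_atTop_zero.comp (Real.tendsto_sqrt_atTop.comp
      tendsto_natCast_atTop_atTop)).prodMk_nhds hc_lim
  have he_meas : TendstoInMeasure gaussianPairs (fun n (_ : ℕ → ℝ × ℝ) => e n) atTop
      fun _ => ((0 : ℝ), (0 : ℝ)) :=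
    tendstoInMeasure_of_tendsto_ae (fun _ => aestronglyMeasurable_const)
      (ae_of_all _ fun _ => he_lim)
  have hW := tendstoInDistribution_featureSum
  have hstat := hW.continuous_comp_prodMk_of_tendstoInMeasure_const
    continuous_truncatedAnderson he_meas fun _ => aemeasurable_const
  have hdet := hW.continuous_comp_prodMk_of_tendstoInMeasure_const
    continuous_covDet he_meas fun _ => aemeasurable_const
  have hone : ∀ u : EuclideanSpace ℝ (Fin 5), covDet (u, 0, 0) = 1 := fun u => by
    simp [covDet, cov11, cov22]
  simp only [hone] at hdet
  -- The determinant converges in law to the constant 1, so the truncation is active with vanishing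
  -- probability; off that event the statistic equals its truncated version for `n ≠ 0`.
  have hsmall : Tendsto (fun n : ℕ => gaussianPairs
      {ω | covDet (featureSum fun i : Fin n => ω i, e n) < 1 / 2}) atTop (𝓝 0) := by
    have h := ProbabilityMeasure.tendsto_measure_of_null_frontier_of_tendsto' hdet.tendsto
      (E := Set.Iio (1 / 2)) (by simp)
    simp only [ProbabilityMeasure.coe_mk] at h
    have hzero : Measure.map (fun _ => (1 : ℝ)) (stdGaussian (EuclideanSpace ℝ (Fin 5)))
        (Set.Iio (1 / 2)) = 0 := by
      rw [Measure.map_const]; simp; norm_num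
    rw [hzero] at h
    refine h.congr fun n => ?_
    rw [Measure.map_apply_of_aemeasurable (hdet.forall_aemeasurable n) measurableSet_Iio]
    rfl
  refine tendstoInDistribution_of_tendstoInMeasure_sub _ _ hstat ?_ fun n =>
    ((measurable_andersonStat θ).comp (measurable_pi_iff.2 fun i =>
      (measurable_spikedMap _ _ _ _).comp (measurable_pi_apply _))).aemeasurable
  intro ε hε
  refine tendsto_of_tendsto_of_tendsto_of_le_of_le' tendsto_const_nhds hsmall
    (Eventually.of_forall fun _ => zero_le) ?_
  filter_upwards [eventually_ne_atTop 0] with n hn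
  refine measure_mono fun ω hω => ?_
  by_contra hnot
  have hnot : 1 / 2 ≤ covDet (featureSum fun i : Fin n => ω i, e n) := not_lt.1 hnot
  have heq := andersonStat_eq_truncatedAnderson hn (m n) (hσ n) (hc n) hθ
    (fun i : Fin n => ω i) hnot
  have : ε ≤ 0 := by
    simpa [heq, he] using hω
  exact absurd hε this.not_gt

/-- A spiked Gaussian sample has the law of the canonical Gaussian sample. -/
theorem map_sample_eq {Ω : Type*} [MeasurableSpace Ω] {P : Measure Ω} [IsProbabilityMeasure P]
    {n : ℕ} {X : Fin n → Ω → EuclideanSpace ℝ (Fin 2)} {m : EuclideanSpace ℝ (Fin 2)}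
    {σ r v : ℝ} (hrv : 0 ≤ r * v) {θ : EuclideanSpace ℝ (Fin 2)} (hθ : ‖θ‖ = 1)
    (hX_indep : iIndepFun X P)
    (hX_law : ∀ i, HasLaw (X i) (multivariateGaussian m (spikedCov σ r v θ)) P) :
    P.map (fun ω i => X i ω) =
      gaussianPairs.map (fun ω (i : Fin n) => spikedMap m σ (1 + r * v) θ (ω i)) := by
  have hm := measurable_spikedMap m σ (1 + r * v) θ
  have hmeas : ∀ i : Fin n, AEMeasurable
      (fun ω : ℕ → ℝ × ℝ => spikedMap m σ (1 + r * v) θ (ω i)) gaussianPairs := fun i =>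
    (hm.comp (measurable_pi_apply (i : ℕ))).aemeasurable
  have hindep : iIndepFun (fun (i : Fin n) (ω : ℕ → ℝ × ℝ) => spikedMap m σ (1 + r * v) θ (ω i))
      gaussianPairs :=
    (iIndepFun_gaussianPairs.precomp Fin.val_injective).comp _ fun _ => hm
  rw [(iIndepFun_iff_map_fun_eq_pi_map fun i => (hX_law i).aemeasurable).1 hX_indep,
    (iIndepFun_iff_map_fun_eq_pi_map hmeas).1 hindep]
  congr 1
  ext1 i
  rw [(hX_law i).map_eq, ← map_spikedMap_gaussian m σ hrv hθ, ← (hasLaw_gaussianPairs i).map_eq,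
    Measure.map_map hm (measurable_pi_apply _)]
  rfl

/-! ### Quantiles and the asymptotic size -/

instance chiSquare_one_nullSingletonClass : NullSingletonClass (chiSquare 1) where
  measure_singleton x := by
    rw [chiSquare_one, Measure.map_apply (by fun_prop) (measurableSet_singleton x)]
    have : NullSingletonClass (gaussianReal 0 1) := nullSingletonClass_gaussianReal one_ne_zero
    refine Set.Finite.measure_zero ?_ _
    refine (Set.toFinite {√x, -√x}).subset fun y hy => ?_
    have hy : y ^ 2 = x := hy
    rcases le_total 0 y with h | h
    · left; rw [← hy, Real.sqrt_sq h]
    · right; simp [← hy, Real.sqrt_sq_eq_abs, abs_of_nonpos h]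

/-- The distribution function vanishes at 0 and is right-continuous, so it stays below `1 - α` on
some interval to the right of 0. -/
theorem upperQuantile_chiSquare_one_pos {α : ℝ} (hα : α ∈ Set.Ioo (0 : ℝ) 1) :
    0 < upperQuantile (chiSquare 1) α := by
  have h0 : cdf (chiSquare 1) 0 = 0 := by
    rw [cdf_eq_real, ← measureReal_congr Iio_ae_eq_Iic, chiSquare_one,
      map_measureReal_apply (by fun_prop) measurableSet_Iio]
    simp [Set.preimage, not_lt.2 (sq_nonneg _)]
  have hright := (cdf (chiSquare 1)).right_continuous 0
  have hev : ∀ᶠ x in 𝓝[≥] (0 : ℝ), cdf (chiSquare 1) x < 1 - α :=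
    hright.eventually_lt_const (by rw [h0]; linarith [hα.2])
  obtain ⟨ε, hε, hsub⟩ := (mem_nhdsGE_iff_exists_Ico_subset).1 hev
  have hε : 0 < ε := hε
  have hmid : cdf (chiSquare 1) (ε / 2) < 1 - α := hsub ⟨by linarith, by linarith⟩
  have hne : {x : ℝ | 1 - α ≤ cdf (chiSquare 1) x}.Nonempty :=
    (((tendsto_cdf_atTop (chiSquare 1)).eventually_const_le
      (by linarith [hα.1] : 1 - α < 1))).exists
  refine lt_of_lt_of_le (half_pos hε) (le_csInf hne fun x hx => ?_)
  by_contra hlt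
  have hx : 1 - α ≤ cdf (chiSquare 1) x := hx
  linarith [monotone_cdf (chiSquare 1) (not_le.1 hlt).le]

/-- As `q > 0`, the point `q/4` lies below the infimum `q`, so the distribution function there is
still less than `1 - α`. -/
theorem lt_chiSquare_one_four_mul {α : ℝ} (hα : α ∈ Set.Ioo (0 : ℝ) 1) :
    α < (chiSquare 1).real {z | upperQuantile (chiSquare 1) α < 4 * z} := by
  have hq := upperQuantile_chiSquare_one_pos hα
  -- `sInf` of a set unbounded below is 0 by convention, which positivity of the quantile excludes.
  have hbdd : BddBelow {x : ℝ | 1 - α ≤ cdf (chiSquare 1) x} := by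
    by_contra h
    rw [upperQuantile, Real.sInf_of_not_bddBelow h] at hq
    exact hq.false
  have hlt : cdf (chiSquare 1) (upperQuantile (chiSquare 1) α / 4) < 1 - α := by
    by_contra h
    have := csInf_le hbdd (not_lt.1 h : _ ∈ {x : ℝ | 1 - α ≤ cdf (chiSquare 1) x})
    change upperQuantile (chiSquare 1) α ≤ _ at this
    linarith
  have hset : {z | upperQuantile (chiSquare 1) α < 4 * z} =
      (Set.Iic (upperQuantile (chiSquare 1) α / 4))ᶜ := by
    ext z
    simp only [Set.mem_ofPred_eq, Set.mem_compl_iff, Set.mem_Iic, not_le]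
    constructor <;> intro h <;> linarith
  rw [hset, probReal_compl_eq_one_sub measurableSet_Iic, ← cdf_eq_real]
  linarith

theorem corollary3p1
    (θ₀ : EuclideanSpace ℝ (Fin 2)) (hθ₀ : ‖θ₀‖ = 1)
    (v : ℝ) (hv : 0 < v)
    (r : ℕ → ℝ) (hr : ∀ n, 0 < r n)
    (hr_lim : Tendsto (fun n : ℕ => √(n : ℝ) * r n) atTop (𝓝 0))
    (μ : ℕ → EuclideanSpace ℝ (Fin 2))
    (σ : ℕ → ℝ) (hσ : ∀ n, 0 < σ n)
    {Ω : ℕ → Type*} [∀ n, MeasurableSpace (Ω n)]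
    (P : (n : ℕ) → Measure (Ω n)) [∀ n, IsProbabilityMeasure (P n)]
    (X : (n : ℕ) → Fin n → Ω n → EuclideanSpace ℝ (Fin 2))
    (hX_indep : ∀ n, iIndepFun (X n) (P n))
    (hX_law : ∀ n i,
      HasLaw (X n i) (multivariateGaussian (μ n) (spikedCov (σ n) (r n) v θ₀)) (P n)) :
    TendstoInDistribution (fun n ω => andersonStat θ₀ (fun i => X n i ω)) atTop
      (fun z : ℝ => 4 * z) P (chiSquare 1) ∧
    ∀ α ∈ Set.Ioo (0 : ℝ) 1,
      Tendsto (fun n => (P n).real {ω | AndersonRejects θ₀ α (fun i => X n i ω)}) atTop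
        (𝓝 ((chiSquare 1).real {z | upperQuantile (chiSquare 1) α < 4 * z})) ∧
      α < (chiSquare 1).real {z | upperQuantile (chiSquare 1) α < 4 * z} := by
  have hrv : ∀ n, 0 ≤ r n * v := fun n => (mul_pos (hr n) hv).le
  have hlim : Tendsto (fun n : ℕ => √(n : ℝ) * (r n * v)) atTop (𝓝 0) := by
    simpa [mul_assoc] using hr_lim.mul_const v
  have hcanon := tendstoInDistribution_andersonStat_spikedMap hθ₀ hrv hlim μ hσ
  have hXmeas : ∀ n, AEMeasurable (fun ω i => X n i ω) (P n) := fun n =>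
    aemeasurable_pi_lambda _ fun i => (hX_law n i).aemeasurable
  have hmeas : ∀ n, AEMeasurable (fun ω => andersonStat θ₀ (fun i => X n i ω)) (P n) := fun n =>
    (measurable_andersonStat θ₀).comp_aemeasurable (hXmeas n)
  -- The sample spaces vary with `n`, but convergence in distribution sees only the laws, so the
  -- canonical space can replace them all.
  have hmap : ∀ n, (P n).map (fun ω => andersonStat θ₀ (fun i => X n i ω)) =
      gaussianPairs.map fun ω : ℕ → ℝ × ℝ =>
        andersonStat θ₀ fun i : Fin n => spikedMap (μ n) (σ n) (1 + r n * v) θ₀ (ω i) := by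
    intro n
    have h1 := AEMeasurable.map_map_of_aemeasurable
      (measurable_andersonStat (n := n) θ₀).aemeasurable (hXmeas n)
    have h2 := Measure.map_map (μ := gaussianPairs) (measurable_andersonStat (n := n) θ₀)
      (measurable_pi_iff.2 fun i : Fin n =>
        (measurable_spikedMap (μ n) (σ n) (1 + r n * v) θ₀).comp (measurable_pi_apply (i : ℕ)))
    refine h1.symm.trans (Eq.trans ?_ h2)
    rw [map_sample_eq (hrv n) hθ₀ (hX_indep n) (hX_law n)]
    rfl
  have hdist : TendstoInDistribution (fun n ω => andersonStat θ₀ (fun i => X n i ω)) atTop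
      (fun z : ℝ => 4 * z) P (chiSquare 1) := by
    refine ⟨hmeas, by fun_prop, ?_⟩
    refine (Filter.tendsto_congr fun n => Subtype.ext (hmap n)).2 (hcanon.tendsto.trans_eq ?_)
    exact congrArg 𝓝 (Subtype.ext map_truncatedAnderson_stdGaussian)
  refine ⟨hdist, fun α hα => ⟨?_, lt_chiSquare_one_four_mul hα⟩⟩
  -- The limit law has no atom at the critical value, so rejection probabilities converge.
  have hfrontier : (chiSquare 1).map (fun z : ℝ => 4 * z)
      (frontier (Set.Ioi (upperQuantile (chiSquare 1) α))) = 0 := by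
    rw [frontier_Ioi, Measure.map_apply (by fun_prop) (measurableSet_singleton _)]
    refine measure_mono_null (t := {upperQuantile (chiSquare 1) α / 4}) (fun z hz => ?_)
      (measure_singleton _)
    have hz : 4 * z = upperQuantile (chiSquare 1) α := hz
    simp [← hz]
  have : IsProbabilityMeasure ((chiSquare 1).map fun z : ℝ => 4 * z) :=
    Measure.isProbabilityMeasure_map (by fun_prop)
  have h := (ENNReal.tendsto_toReal (measure_ne_top ((chiSquare 1).map fun z : ℝ => 4 * z)
    (Set.Ioi (upperQuantile (chiSquare 1) α)))).comp
    (ProbabilityMeasure.tendsto_measure_of_null_frontier_of_tendsto' hdist.tendsto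
      (E := Set.Ioi (upperQuantile (chiSquare 1) α)) hfrontier)
  simp only [ProbabilityMeasure.coe_mk, Function.comp_def] at h
  rw [Measure.map_apply (by fun_prop) measurableSet_Ioi] at h
  refine h.congr fun n => ?_
  rw [Measure.map_apply_of_aemeasurable (hmeas n) measurableSet_Ioi]
  rfl
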